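/- Let $F:[0,1]\to\mathbb{R}$ be a function of bounded variation, with total variation $\mathcal{V}(F)$. Let $\mathcal{D}\subset\mathbb{Z}_{\ge 1}$ be an infinite set of positive integers and, for every $d\in\mathcal{D}$, let $H_d$ be a subset of $(\mathbb{Z}/d\mathbb{Z})^\times$ and $a_d$ an element of $(\mathbb{Z}/d\mathbb{Z})^\times$. Assume that $|H_d|/\log\log d\to+\infty$ as $d\to\infty$ in $\mathcal{D}$. Then for every $\epsilon\in(0,1/4)$ one has, for all sufficiently large $d\in\mathcal{D}$, $$\frac{1}{\phi(d)}\sum_{g\in(\mathbb{Z}/d\mathbb{Z})^\times}\left|\int_0^1F(t)\,dt-\frac{1}{|H_d|}\sum_{h\in H_d}F\left(\left\{\frac{a_d\,gh}{d}\right\}\right)\right|\le c_7\cdot\mathcal{V}(F)\cdot\left(\frac{\log\log d}{|H_d|}\right)^{1/4-\epsilon},$$ where $\phi$ is Euler's totient function, $\{x\}$ is the fractional part of $x$, and $c_7>0$ is an effective constant that depends at most on $\epsilon$; explicitly, one can take $c_7=12+\dfrac{e^{\gamma}}{36\pi^3}\,\epsilon^{-2}$, where $\gamma$ is the Euler-Mascheroni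 constant. -/

import Mathlib

open Filter

noncomputable section

/-- The point `{m / d}` of `[0, 1]` attached to a residue class `m` modulo `d`. -/
def residuePoint (d : ℕ+) (m : ZMod d) : ℝ :=
  Int.fract ((m.val : ℝ) / (d : ℝ))

/-- The average over `g ∈ (ℤ/dℤ)ˣ` of
`|∫₀¹ F - (1/|H|) ∑_{h ∈ H} F({a g h / d})|`. -/
def meanDeviation (F : ℝ → ℝ) (d : ℕ+) (H : Finset (ZMod d)ˣ) (a : (ZMod d)ˣ) : ℝ :=
  (1 / (Nat.totient d : ℝ)) * ∑ g : (ZMod d)ˣ,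
    |(∫ t in (0 : ℝ)..1, F t) -
      (1 / (H.card : ℝ)) * ∑ h ∈ H, F (residuePoint d ((a * (g * h) : (ZMod d)ˣ) : ZMod d))|

/-- The total variation of `F` on `[0, 1]` (used only where it is finite). -/
def totalVariation (F : ℝ → ℝ) : ℝ :=
  (eVariationOn F (Set.Icc 0 1)).toReal

/-- An explicit admissible constant, depending only on `ε`. -/
def equidistributionConstant (ε : ℝ) : ℝ :=
  12 + Real.exp Real.eulerMascheroniConstant / (36 * Real.pi ^ 3) * ε⁻¹ ^ 2

end

/-! Write `q = log log d / |H|`. The proof gives a mean deviation of at most `C * V(F) * q ^ (1 /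
4)` with an absolute constant `C`. Since `q → 0`, the spare factor `q ^ ε` eventually brings `C * q
^ ε` below 12, so the explicit constant costs nothing: the size of `C` only affects how large `d`
must be.

By Abel summation on the grid `i / d` (Koksma's inequality, in mean), it suffices to bound the mean
over `g` of the discrepancy of the orbit on `[0, x)`, uniformly in `x`. The centred indicator of
`[0, x)` is a difference of two translates of the sawtooth. The Fourier series of the sawtooth is
not absolutely convergent, so the sawtooth is compared with difference quotients, of step `δ`, of
its primitive, half the second Bernoulli function, whose coefficients are `O(1 / n ^ 2)`.

For the frequency `n`, orthogonality modulo `d` bounds the second moment of the exponential sums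
over `H` (`sum_sq_norm_expSum_le`), and Cauchy-Schwarz bounds their normalised mean by `√n * √(d /
(φ(d) |H|))`. As `∑ n ^ (-3 / 2)` converges and `d / φ(d) = O(log log d)` (`div_totient_le`), the
primitive has mean `M = O(q ^ (1 / 2))`. The sawtooth then costs `δ + 3 * M / δ`, and `δ = q ^ (1 /
4)` balances the two terms. -/

/-! ### Sums over primes and the order of `d / φ(d)`. -/

/-- The weak Mertens bound, from the divisibility of `n!` by `∏ p ^ (n / p)`. -/
theorem sum_log_prime_div_le (n : ℕ) :
    ∑ p ∈ (Finset.range (n + 1)).filter Nat.Prime, Real.log p / p ≤ 2 * Real.log n := by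
  rcases Nat.eq_zero_or_pos n with rfl | hn
  · simp [Finset.sum_filter, Nat.not_prime_zero]
  have hn' : (0 : ℝ) < n := by exact_mod_cast hn
  have hdvd : ∏ p ∈ (Finset.range (n + 1)).filter Nat.Prime, p ^ (n / p) ∣ n.factorial := by
    refine Finset.prod_dvd_of_isRelPrime ?_ ?_
    · intro p hp q hq hpq
      rw [Function.onFun, ← Nat.coprime_iff_isRelPrime]
      simp only [Finset.coe_filter, Set.mem_ofPred_eq] at hp hq
      exact Nat.Coprime.pow _ _ ((Nat.coprime_primes hp.2 hq.2).2 hpq)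
    · intro p hp
      simp only [Finset.mem_filter] at hp
      rw [hp.2.pow_dvd_factorial_iff (b := Nat.log p n + 2) (by omega)]
      have := Finset.single_le_sum (f := fun i => n / p ^ i) (fun i _ => Nat.zero_le _)
        (show 1 ∈ Finset.Ico 1 (Nat.log p n + 2) by simp)
      simpa using this
  have hle : ∏ p ∈ (Finset.range (n + 1)).filter Nat.Prime, p ^ (n / p) ≤ n ^ n :=
    (Nat.le_of_dvd (Nat.factorial_pos n) hdvd).trans (Nat.factorial_le_pow n)
  have hlog : ∑ p ∈ (Finset.range (n + 1)).filter Nat.Prime, ((n / p : ℕ) : ℝ) * Real.log p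
      ≤ n * Real.log n := by
    have h1 : ((∏ p ∈ (Finset.range (n + 1)).filter Nat.Prime, p ^ (n / p) : ℕ) : ℝ) ≤
        ((n ^ n : ℕ) : ℝ) := by exact_mod_cast hle
    have h0 : (0 : ℝ) < ((∏ p ∈ (Finset.range (n + 1)).filter Nat.Prime, p ^ (n / p) : ℕ) : ℝ) := by
      have : 0 < ∏ p ∈ (Finset.range (n + 1)).filter Nat.Prime, p ^ (n / p) :=
        Finset.prod_pos fun p hp => pow_pos (Finset.mem_filter.1 hp).2.pos _
      exact_mod_cast this
    have h2 := Real.log_le_log h0 h1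
    push_cast at h2
    rw [Real.log_pow, Real.log_prod] at h2
    · simpa [Real.log_pow] using h2
    · intro p hp
      have := (Finset.mem_filter.1 hp).2.pos
      positivity
  have hterm : ∀ p ∈ (Finset.range (n + 1)).filter Nat.Prime,
      Real.log p / p ≤ (2 / n) * (((n / p : ℕ) : ℝ) * Real.log p) := by
    intro p hp
    simp only [Finset.mem_filter, Finset.mem_range] at hp
    have hp0 : 0 < p := hp.2.pos
    have hp0' : (0 : ℝ) < p := by exact_mod_cast hp0
    have hl : 0 ≤ Real.log p := Real.log_natCast_nonneg p
    have h1 : 1 ≤ n / p := (Nat.one_le_div_iff hp0).2 (by omega)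
    have h2 : n < p * (n / p + 1) := Nat.lt_mul_div_succ n hp0
    -- Since `⌊n / p⌋ ≥ 1`, the real quotient `n / p` is less than `⌊n / p⌋ + 1 ≤ 2 * ⌊n / p⌋`; this
    -- is the source of the factor 2.
    have h3 : (n : ℝ) ≤ p * (2 * ((n / p : ℕ) : ℝ)) := by
      have : n ≤ p * (2 * (n / p)) := h2.le.trans (Nat.mul_le_mul_left p (by omega))
      exact_mod_cast this
    rw [div_le_iff₀ hp0']
    have : (2 / n) * (((n / p : ℕ) : ℝ) * Real.log p) * p
        = Real.log p * ((p * (2 * ((n / p : ℕ) : ℝ))) / n) := by ring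
    rw [this]
    exact le_mul_of_one_le_right hl ((one_le_div hn').2 h3)
  calc _ ≤ ∑ p ∈ (Finset.range (n + 1)).filter Nat.Prime,
        (2 / n) * (((n / p : ℕ) : ℝ) * Real.log p) := Finset.sum_le_sum hterm
    _ = (2 / n) * ∑ p ∈ (Finset.range (n + 1)).filter Nat.Prime,
        (((n / p : ℕ) : ℝ) * Real.log p) := by rw [Finset.mul_sum]
    _ ≤ (2 / n) * (n * Real.log n) := by gcongr
    _ = 2 * Real.log n := by field_simp

theorem sum_log_primeFactors_le {d : ℕ} (hd : d ≠ 0) :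
    ∑ p ∈ d.primeFactors, Real.log p ≤ Real.log d := by
  rw [← Real.log_prod (fun p hp => by
    have := (Nat.prime_of_mem_primeFactors hp).pos
    positivity)]
  refine Real.log_le_log ?_ ?_
  · exact Finset.prod_pos fun p hp => by exact_mod_cast (Nat.prime_of_mem_primeFactors hp).pos
  · have := Nat.le_of_dvd (Nat.pos_of_ne_zero hd) (Nat.prod_primeFactors_dvd d)
    rw [← Nat.cast_prod]
    exact_mod_cast this

/-- Cut at `L = log d`. Primes up to `L` are covered by the weak Mertens bound; for the larger ones
`1 / p ≤ 1 / L`, and the logarithms of all prime factors add up to at most `L`. -/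
theorem sum_log_div_primeFactors_le {d : ℕ} (hd : 1 ≤ Real.log d) :
    ∑ p ∈ d.primeFactors, Real.log p / p ≤ 2 * Real.log (Real.log d) + 1 := by
  have hd0 : d ≠ 0 := by
    rintro rfl
    norm_num at hd
  set L := Real.log d with hL
  have hL0 : 0 < L := by linarith
  have hfl : 1 ≤ ⌊L⌋₊ := Nat.one_le_floor_iff _ |>.2 hd
  rw [← Finset.sum_filter_add_sum_filter_not d.primeFactors (fun p => p < ⌊L⌋₊ + 1)]
  refine add_le_add ?_ ?_
  · calc _ ≤ ∑ p ∈ (Finset.range (⌊L⌋₊ + 1)).filter Nat.Prime, Real.log p / p := by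
          refine Finset.sum_le_sum_of_subset_of_nonneg ?_ ?_
          · intro p hp
            simp only [Finset.mem_filter, Finset.mem_range] at hp ⊢
            exact ⟨hp.2, Nat.prime_of_mem_primeFactors hp.1⟩
          · intro p _ _
            have := Real.log_natCast_nonneg p
            positivity
      _ ≤ 2 * Real.log ⌊L⌋₊ := sum_log_prime_div_le _
      _ ≤ 2 * Real.log L := by
          have : (⌊L⌋₊ : ℝ) ≤ L := Nat.floor_le hL0.le
          have h1 : (0 : ℝ) < ⌊L⌋₊ := by exact_mod_cast hfl
          gcongr
  · calc _ ≤ ∑ p ∈ d.primeFactors with ¬ p < ⌊L⌋₊ + 1, Real.log p / L := by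
          refine Finset.sum_le_sum fun p hp => ?_
          have h1 := (Finset.mem_filter.1 hp).2
          have h2 : L < p := Nat.lt_of_floor_lt (by omega)
          have := Real.log_natCast_nonneg p
          gcongr
      _ ≤ ∑ p ∈ d.primeFactors, Real.log p / L := by
          refine Finset.sum_le_sum_of_subset_of_nonneg (Finset.filter_subset _ _) fun p _ _ => ?_
          have := Real.log_natCast_nonneg p
          positivity
      _ ≤ 1 := by
          rw [← Finset.sum_div, div_le_one hL0]
          exact sum_log_primeFactors_le hd0

/-- The monoid homomorphism `n ↦ n ^ (-s)`. -/
noncomputable def natRpowNegHom (s : ℝ) : ℕ →* ℝ where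
  toFun n := (n : ℝ) ^ (-s)
  map_one' := by simp
  map_mul' m n := by
    push_cast
    exact Real.mul_rpow (Nat.cast_nonneg m) (Nat.cast_nonneg n)

/-- The product expands into a subseries of `ζ(s)`, which is at most `1 + 1 / (s - 1)`. -/
theorem prod_primeFactors_inv_one_sub_rpow_le (d : ℕ) {s : ℝ} (hs : 1 < s) :
    ∏ p ∈ d.primeFactors, (1 - (p : ℝ) ^ (-s))⁻¹ ≤ 1 + 1 / (s - 1) := by
  have hsum : Summable (natRpowNegHom s : ℕ → ℝ) :=
    (Real.summable_nat_rpow (p := -s)).2 (by linarith)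
  have h := EulerProduct.prod_filter_prime_geometric_eq_tsum_factoredNumbers hsum d.primeFactors
  rw [Finset.filter_true_of_mem (fun p hp => Nat.prime_of_mem_primeFactors hp)] at h
  have hnn : ∀ n, 0 ≤ natRpowNegHom s n := fun n => Real.rpow_nonneg (Nat.cast_nonneg n) _
  have h1 : ∑' (m : ↑(Nat.factoredNumbers d.primeFactors)), natRpowNegHom s m ≤
      ∑' n, natRpowNegHom s n := hsum.tsum_subtype_le _ _ hnn
  have h2 : ∑' n, natRpowNegHom s n = ∑' n : ℕ, 1 / ((n : ℝ) + 1) ^ s := by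
    rw [hsum.tsum_eq_zero_add]
    have : natRpowNegHom s 0 = 0 := by
      change ((0 : ℕ) : ℝ) ^ (-s) = 0
      rw [Nat.cast_zero, Real.zero_rpow (by linarith)]
    rw [this, zero_add]
    refine tsum_congr fun n => ?_
    change ((n + 1 : ℕ) : ℝ) ^ (-s) = _
    rw [Real.rpow_neg (by positivity)]
    push_cast
    rw [one_div]
  have h3 := ZetaAsymptotics.zeta_limit_aux1 hs
  have h4 : 0 ≤ ZetaAsymptotics.termTSum s := tsum_nonneg fun n => ZetaAsymptotics.term_nonneg _ _
  have h5 : 0 ≤ s * ZetaAsymptotics.termTSum s := mul_nonneg (by linarith) h4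
  change ∏ p ∈ d.primeFactors, (1 - (p : ℝ) ^ (-s))⁻¹ = _ at h
  rw [h]
  linarith

/-- The price of moving an Euler factor from exponent 1 to `s`. From `1 - x ≤ exp (-x)`, the
difference `p⁻¹ - p ^ (-s)` is at most `u = (s - 1) * log p / p`; the 2 in the exponent compensates
for `1 - p⁻¹ ≥ 1 / 2`. -/
theorem inv_one_sub_inv_le {p s : ℝ} (hp : 2 ≤ p) (hs : 1 < s) :
    (1 - p⁻¹)⁻¹ ≤ (1 - p ^ (-s))⁻¹ * Real.exp (2 * (s - 1) * (Real.log p / p)) := by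
  have hp0 : 0 < p := by linarith
  have hinv : p⁻¹ ≤ 1 / 2 := by
    rw [inv_eq_one_div]
    exact one_div_le_one_div_of_le (by norm_num) hp
  have hrp : p ^ (-s) < 1 := Real.rpow_lt_one_of_one_lt_of_neg (by linarith) (by linarith)
  have hkey : p⁻¹ - p ^ (-s) ≤ (s - 1) * (Real.log p / p) := by
    have h1 : p ^ (-s) = p⁻¹ * Real.exp (-((s - 1) * Real.log p)) := by
      rw [← Real.rpow_neg_one, Real.rpow_def_of_pos hp0, Real.rpow_def_of_pos hp0, ← Real.exp_add]
      ring_nf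
    have h2 := Real.add_one_le_exp (-((s - 1) * Real.log p))
    rw [h1]
    have h3 : 0 < p⁻¹ := by positivity
    have h4 := mul_le_mul_of_nonneg_left h2 h3.le
    have h5 : (s - 1) * (Real.log p / p) = p⁻¹ * ((s - 1) * Real.log p) := by
      field_simp
    rw [h5]
    linarith
  have ha : 0 < 1 - p⁻¹ := by linarith
  have hb : 0 < 1 - p ^ (-s) := by linarith
  have hlogp : 0 ≤ Real.log p := Real.log_nonneg (by linarith)
  have hu : 0 ≤ (s - 1) * (Real.log p / p) :=
    mul_nonneg (by linarith) (by positivity)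
  set u := (s - 1) * (Real.log p / p) with hu_def
  have he := Real.add_one_le_exp (2 * u)
  have h6 : 2 * (s - 1) * (Real.log p / p) = 2 * u := by rw [hu_def]; ring
  rw [h6, inv_mul_eq_div, le_div_iff₀ hb, inv_mul_le_iff₀ ha]
  calc 1 - p ^ (-s) ≤ (1 - p⁻¹) + u := by linarith
    _ ≤ (1 - p⁻¹) * (2 * u + 1) := by nlinarith
    _ ≤ _ := by gcongr

/-- `n / φ(n) = O(log log n)`. -/
theorem div_totient_le {d : ℕ} (hd : 1 ≤ Real.log (Real.log d)) :
    (d : ℝ) / Nat.totient d ≤ 2 * Real.exp 6 * Real.log (Real.log d) := by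
  set ℓ := Real.log (Real.log d) with hℓ
  have hL0 : 0 < Real.log d := by
    by_contra hneg
    have h0 : 0 ≤ Real.log d := Real.log_natCast_nonneg d
    have h1 : Real.log d = 0 := le_antisymm (not_lt.1 hneg) h0
    rw [hℓ, h1, Real.log_zero] at hd
    norm_num at hd
  have hL1 : 1 ≤ Real.log d := by
    have := Real.log_le_sub_one_of_pos hL0
    linarith
  have hd0 : d ≠ 0 := by
    rintro rfl
    simp at hL0
  have hd0' : (d : ℝ) ≠ 0 := by exact_mod_cast hd0
  have htot : (Nat.totient d : ℝ) = d * ∏ p ∈ d.primeFactors, (1 - (p : ℝ)⁻¹) := by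
    have h := Nat.totient_eq_mul_prod_factors d
    have h' : (((Nat.totient d : ℚ)) : ℝ) = ((d * ∏ p ∈ d.primeFactors, (1 - (p : ℚ)⁻¹) : ℚ) : ℝ) :=
      congrArg _ h
    push_cast at h'
    exact h'
  -- With `s - 1 = 1 / ℓ` the shifted product is at most `1 + ℓ`, while the exponent of the
  -- correction, at most `(2 / ℓ) * (2 * ℓ + 1)`, stays below 6.
  set s : ℝ := 1 + 1 / ℓ with hs_def
  have hℓ0 : 0 < ℓ := by linarith
  have hs : 1 < s := by
    rw [hs_def]
    have : 0 < 1 / ℓ := by positivity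
    linarith
  have hs1 : s - 1 = 1 / ℓ := by rw [hs_def]; ring
  have hsum := sum_log_div_primeFactors_le hL1
  calc (d : ℝ) / Nat.totient d = ∏ p ∈ d.primeFactors, (1 - (p : ℝ)⁻¹)⁻¹ := by
        rw [htot, Finset.prod_inv_distrib, div_mul_eq_div_div, div_self hd0', one_div]
    _ ≤ ∏ p ∈ d.primeFactors,
        ((1 - (p : ℝ) ^ (-s))⁻¹ * Real.exp (2 * (s - 1) * (Real.log p / p))) := by
        refine Finset.prod_le_prod (fun p hp => ?_) fun p hp => ?_
        · have : (2 : ℝ) ≤ p := by exact_mod_cast (Nat.prime_of_mem_primeFactors hp).two_le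
          have : (p : ℝ)⁻¹ ≤ 1 := inv_le_one_of_one_le₀ (by linarith)
          exact inv_nonneg.2 (by linarith)
        · exact inv_one_sub_inv_le
            (by exact_mod_cast (Nat.prime_of_mem_primeFactors hp).two_le) hs
    _ = (∏ p ∈ d.primeFactors, (1 - (p : ℝ) ^ (-s))⁻¹) *
        Real.exp (2 * (s - 1) * ∑ p ∈ d.primeFactors, Real.log p / p) := by
        rw [Finset.prod_mul_distrib, ← Real.exp_sum, Finset.mul_sum]
    _ ≤ (1 + 1 / (s - 1)) * Real.exp 6 := by
        refine mul_le_mul (prod_primeFactors_inv_one_sub_rpow_le d hs) ?_ (Real.exp_pos _).le ?_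
        · refine Real.exp_le_exp.2 ?_
          rw [hs1]
          calc 2 * (1 / ℓ) * ∑ p ∈ d.primeFactors, Real.log p / p
              ≤ 2 * (1 / ℓ) * (2 * ℓ + 1) := by gcongr
            _ ≤ 2 * (1 / ℓ) * (2 * ℓ + ℓ) := by gcongr
            _ = 6 := by field_simp; norm_num
        · have : 0 < s - 1 := by linarith
          positivity
    _ ≤ 2 * Real.exp 6 * ℓ := by
        rw [hs1, one_div_one_div]
        nlinarith [Real.exp_pos 6]

/-! ### Exponential sums over `H` in mean square. -/

open Classical in
-- Summing over all residues `g`, orthogonality leaves `d` times the number of pairs with `n * a *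
-- (h - h') = 0`. As `a` is a unit, for fixed `h` these `h'` inject into the `n`-torsion of a cyclic
-- group, which has at most `n` elements.
theorem sum_sq_norm_expSum_le (d : ℕ) [NeZero d] {n : ℕ} (hn : 0 < n) (H : Finset (ZMod d)ˣ)
    (a : (ZMod d)ˣ) :
    ∑ g : ZMod d, ‖∑ h ∈ H, ZMod.stdAddChar ((n : ZMod d) * ((a : ZMod d) * (g * (h : ZMod d))))‖ ^ 2
      ≤ (d : ℝ) * (n * H.card) := by
  have hcount : ∀ h ∈ H, (H.filter fun h' : (ZMod d)ˣ =>
      (n : ZMod d) * ((a : ZMod d) * ((h : ZMod d) - (h' : ZMod d))) = 0).card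
      ≤ n := by
    intro h _
    refine le_trans ?_ (IsAddCyclic.card_nsmul_eq_zero_le (α := ZMod d) hn)
    refine Finset.card_le_card_of_injOn (fun h' : (ZMod d)ˣ => (a : ZMod d) * ((h : ZMod d) - (h' : ZMod d)))
      ?_ ?_
    · intro h' hh'
      have := (Finset.mem_filter.1 hh').2
      simp [nsmul_eq_mul, this]
    · intro x _ y _ hxy
      have h1 := a.isUnit.mul_left_cancel hxy
      exact Units.ext (sub_right_injective h1)
  have hexp : ∀ g : ZMod d,
      ((‖∑ h ∈ H, ZMod.stdAddChar ((n : ZMod d) * ((a : ZMod d) * (g * (h : ZMod d))))‖ ^ 2 : ℝ) : ℂ)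
      = ∑ h ∈ H, ∑ h' ∈ H, ZMod.stdAddChar (g * ((n : ZMod d) * ((a : ZMod d) * ((h : ZMod d) - (h' : ZMod d))))) := by
    intro g
    push_cast
    rw [← Complex.mul_conj', map_sum, Finset.sum_mul_sum]
    refine Finset.sum_congr rfl fun h _ => Finset.sum_congr rfl fun h' _ => ?_
    rw [← AddChar.map_neg_eq_conj, ← AddChar.map_add_eq_mul]
    congr 1
    ring
  have hC : ((∑ g : ZMod d, ‖∑ h ∈ H, ZMod.stdAddChar ((n : ZMod d) * ((a : ZMod d) * (g * (h : ZMod d))))‖ ^ 2 : ℝ) : ℂ)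
      = ((d * ∑ h ∈ H,
        ((H.filter fun h' : (ZMod d)ˣ =>
      (n : ZMod d) * ((a : ZMod d) * ((h : ZMod d) - (h' : ZMod d))) = 0).card : ℝ) : ℝ) : ℂ) := by
    rw [Complex.ofReal_sum, Finset.sum_congr rfl fun g _ => hexp g, Finset.sum_comm]
    push_cast
    rw [Finset.mul_sum]
    refine Finset.sum_congr rfl fun h _ => ?_
    rw [Finset.sum_comm, Finset.sum_congr rfl fun h' _ =>
      AddChar.sum_mulShift _ (ZMod.isPrimitive_stdAddChar d), ZMod.card, Finset.card_filter]
    push_cast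
    rw [Finset.mul_sum]
    refine Finset.sum_congr rfl fun h' _ => ?_
    split_ifs <;> simp
  rw [Complex.ofReal_injective hC]
  gcongr
  calc _ ≤ ∑ h ∈ H, (n : ℝ) := Finset.sum_le_sum fun h hh => by exact_mod_cast hcount h hh
    _ = n * H.card := by rw [Finset.sum_const, nsmul_eq_mul, mul_comm]

/-- The mean over the units of the normalised exponential sums. -/
theorem mean_norm_expSum_le (d : ℕ) [NeZero d] {n : ℕ} (hn : 0 < n) {H : Finset (ZMod d)ˣ}
    (hH : H.Nonempty) (a : (ZMod d)ˣ) :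
    (1 / (Nat.totient d : ℝ)) * ∑ g : (ZMod d)ˣ,
      ((1 / (H.card : ℝ)) * ‖∑ h ∈ H, ZMod.stdAddChar ((n : ZMod d) * ((a * (g * h) : (ZMod d)ˣ) : ZMod d))‖)
      ≤ √n * √((d : ℝ) / Nat.totient d / H.card) := by
  have hφ : (0 : ℝ) < Nat.totient d := by
    exact_mod_cast Nat.totient_pos.2 (NeZero.pos d)
  have hc : (0 : ℝ) < H.card := by exact_mod_cast hH.card_pos
  set S : (ZMod d)ˣ → ℝ := fun g =>
    ‖∑ h ∈ H, ZMod.stdAddChar ((n : ZMod d) * ((a * (g * h) : (ZMod d)ˣ) : ZMod d))‖ with hS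
  have h1 : (∑ g, S g) ^ 2 ≤ Nat.totient d * ∑ g, S g ^ 2 := by
    have := sq_sum_le_card_mul_sum_sq (s := (Finset.univ : Finset (ZMod d)ˣ)) (f := S)
    rwa [Finset.card_univ, ZMod.card_units_eq_totient] at this
  -- Positivity allows the sum over units to be enlarged to all residues; the mean is still
  -- normalised by `φ(d)`, whence the factor `d / φ(d)`.
  have h2 : ∑ g, S g ^ 2 ≤ d * (n * H.card) := by
    refine le_trans ?_ (sum_sq_norm_expSum_le d hn H a)
    have hinj : Function.Injective (fun u : (ZMod d)ˣ => (u : ZMod d)) := Units.val_injective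
    have : ∑ g, S g ^ 2 = ∑ x ∈ Finset.univ.map ⟨_, hinj⟩,
        ‖∑ h ∈ H, ZMod.stdAddChar ((n : ZMod d) * ((a : ZMod d) * (x * (h : ZMod d))))‖ ^ 2 := by
      rw [Finset.sum_map]
      rfl
    rw [this]
    exact Finset.sum_le_sum_of_subset_of_nonneg (Finset.subset_univ _) fun _ _ _ => sq_nonneg _
  rw [← Real.sqrt_mul (Nat.cast_nonneg n), ← Finset.mul_sum]
  change (1 / (Nat.totient d : ℝ)) * ((1 / (H.card : ℝ)) * ∑ g, S g) ≤ _
  refine Real.le_sqrt_of_sq_le ?_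
  calc _ = (∑ g, S g) ^ 2 / ((Nat.totient d) ^ 2 * (H.card : ℝ) ^ 2) := by field_simp
    _ ≤ (Nat.totient d * (d * (n * H.card))) / ((Nat.totient d) ^ 2 * (H.card : ℝ) ^ 2) := by
        gcongr
        exact h1.trans (by gcongr)
    _ = _ := by field_simp

/-! ### The sawtooth, its primitive and their difference inequalities. -/

/-- The periodic sawtooth `{u} - 1/2`. -/
noncomputable def sawtooth (u : ℝ) : ℝ := Int.fract u - 1 / 2

/-- Half the second periodic Bernoulli function, a primitive of the sawtooth. -/
noncomputable def sawtoothPrimitive (u : ℝ) : ℝ := (Int.fract u ^ 2 - Int.fract u + 1 / 6) / 2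

theorem hasSum_sawtoothPrimitive (u : ℝ) :
    HasSum (fun n : ℕ => 1 / (2 * Real.pi ^ 2) * (1 / (n : ℝ) ^ 2 * Real.cos (2 * Real.pi * n * u)))
      (sawtoothPrimitive u) := by
  have h := hasSum_one_div_nat_pow_mul_cos one_ne_zero
    (x := Int.fract u) ⟨Int.fract_nonneg u, (Int.fract_lt_one u).le⟩
  have h2 := h.mul_left (1 / (2 * Real.pi ^ 2))
  have hb : Polynomial.eval (Int.fract u)
      (Polynomial.map (algebraMap ℚ ℝ) (Polynomial.bernoulli (2 * 1))) =
      Int.fract u ^ 2 - Int.fract u + 1 / 6 := by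
    simp [Polynomial.bernoulli, Finset.sum_range_succ, bernoulli_two]
    ring
  rw [hb] at h2
  have hv : sawtoothPrimitive u = 1 / (2 * Real.pi ^ 2) * ((-1) ^ (1 + 1) *
      (2 * Real.pi) ^ (2 * 1) / 2 / (2 * 1).factorial * (Int.fract u ^ 2 - Int.fract u + 1 / 6)) := by
    unfold sawtoothPrimitive
    have := Real.pi_ne_zero
    norm_num [Nat.factorial]
    field_simp
  rw [hv]
  refine h2.congr_fun fun n => ?_
  have : 2 * Real.pi * n * u =
      2 * Real.pi * n * Int.fract u + ((n * ⌊u⌋ : ℤ) : ℝ) * (2 * Real.pi) := by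
    push_cast
    nth_rewrite 1 [← Int.floor_add_fract u]
    ring
  rw [this, Real.cos_add_int_mul_two_pi, mul_one]

theorem fract_add_cases {t δ : ℝ} (hδ : 0 ≤ δ) (hδ' : δ < 1) :
    (Int.fract (t + δ) = Int.fract t + δ ∧ Int.fract t + δ < 1) ∨
    (Int.fract (t + δ) = Int.fract t + δ - 1 ∧ 1 ≤ Int.fract t + δ) := by
  have h0 := Int.fract_nonneg t
  have h1 := Int.fract_lt_one t
  have h2 := Int.floor_add_fract t
  rcases lt_or_ge (Int.fract t + δ) 1 with h | h
  · refine Or.inl ⟨?_, h⟩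
    rw [Int.fract_eq_iff]
    exact ⟨by linarith, h, ⌊t⌋, by linarith⟩
  · refine Or.inr ⟨?_, h⟩
    rw [Int.fract_eq_iff]
    exact ⟨by linarith, by linarith, ⌊t⌋ + 1, by push_cast; linarith⟩

/-- The sawtooth increases with slope 1 and jumps only downwards, so over a step `δ` it never
exceeds its initial value plus `δ`. Hence the forward difference of the primitive bounds `δ *
sawtooth t` from below, and the backward one bounds it from above, up to `δ ^ 2`. -/
theorem sawtoothPrimitive_add_sub_le {t δ : ℝ} (hδ : 0 ≤ δ) (hδ' : δ < 1) :
    sawtoothPrimitive (t + δ) - sawtoothPrimitive t ≤ δ * sawtooth t + δ ^ 2 := by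
  unfold sawtoothPrimitive sawtooth
  rcases fract_add_cases (t := t) hδ hδ' with ⟨h, h'⟩ | ⟨h, h'⟩ <;> rw [h] <;> nlinarith

theorem mul_sawtooth_le_sub {t δ : ℝ} (hδ : 0 ≤ δ) (hδ' : δ < 1) :
    δ * sawtooth t ≤ sawtoothPrimitive t - sawtoothPrimitive (t - δ) + δ ^ 2 := by
  obtain ⟨s, rfl⟩ : ∃ s, t = s + δ := ⟨t - δ, by ring⟩
  rw [add_sub_cancel_right]
  unfold sawtoothPrimitive sawtooth
  rcases fract_add_cases (t := s) hδ hδ' with ⟨h, h'⟩ | ⟨h, h'⟩ <;> rw [h] <;>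
    nlinarith [Int.fract_lt_one s]

theorem ite_lt_sub_eq_sawtooth_sub {t x : ℝ} (ht : 0 ≤ t) (ht' : t < 1) (hx : 0 ≤ x) (hx' : x ≤ 1) :
    (if t < x then 1 else 0) - x = sawtooth (t + (-x)) - sawtooth (t + 0) := by
  unfold sawtooth
  rw [add_zero, Int.fract_eq_self.2 ⟨ht, ht'⟩]
  split_ifs with h
  · have : Int.fract (t + -x) = t - x + 1 := by
      rw [Int.fract_eq_iff]
      exact ⟨by linarith, by linarith, -1, by push_cast; ring⟩
    rw [this]
    ring
  · have : Int.fract (t + -x) = t - x := by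
      rw [Int.fract_eq_iff]
      exact ⟨by linarith [not_lt.1 h], by linarith, 0, by push_cast; ring⟩
    rw [this]
    ring

/-! ### Orbit averages and their means over the units. -/

/-- The average of `f` over the points `{a g h / d}`, `h ∈ H`. -/
noncomputable def orbitAverage (d : ℕ+) (H : Finset (ZMod d)ˣ) (a : (ZMod d)ˣ) (f : ℝ → ℝ)
    (g : (ZMod d)ˣ) : ℝ :=
  (1 / (H.card : ℝ)) * ∑ h ∈ H, f (residuePoint d ((a * (g * h) : (ZMod d)ˣ) : ZMod d))

/-- The mean absolute value of a function on the units modulo `d`. -/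
noncomputable def unitsMeanAbs (d : ℕ+) (X : (ZMod d)ˣ → ℝ) : ℝ :=
  (1 / (Nat.totient d : ℝ)) * ∑ g : (ZMod d)ˣ, |X g|

theorem residuePoint_eq (d : ℕ+) (m : ZMod d) : residuePoint d m = (m.val : ℝ) / (d : ℝ) := by
  have hd : (0 : ℝ) < (d : ℕ) := by exact_mod_cast d.pos
  have := ZMod.val_lt m
  exact Int.fract_eq_self.2 ⟨by positivity, (div_lt_one hd).2 (by exact_mod_cast this)⟩

theorem cos_residuePoint_eq (d : ℕ+) (n : ℕ) (y : ℝ) (m : ZMod d) :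
    Real.cos (2 * Real.pi * n * (residuePoint d m + y)) =
      (Complex.exp ((2 * Real.pi * n * y : ℝ) * Complex.I) *
        ZMod.stdAddChar ((n : ZMod d) * m)).re := by
  have h1 : (n : ZMod d) * m = ((n * m.val : ℤ) : ZMod d) := by
    push_cast
    rw [ZMod.natCast_zmod_val]
  rw [h1, ZMod.stdAddChar_coe, ← Complex.exp_add, residuePoint_eq]
  have h2 : ((2 * Real.pi * n * y : ℝ) * Complex.I) +
      2 * Real.pi * Complex.I * ((n * m.val : ℤ) : ℂ) / ((d : ℕ) : ℂ) =
      ((2 * Real.pi * n * ((m.val : ℝ) / ((d : ℕ) : ℝ) + y) : ℝ) : ℂ) * Complex.I := by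
    push_cast
    ring
  rw [h2, Complex.exp_ofReal_mul_I_re]

theorem abs_orbitAverage_cos_le (d : ℕ+) (H : Finset (ZMod d)ˣ) (a : (ZMod d)ˣ) (n : ℕ) (y : ℝ)
    (g : (ZMod d)ˣ) :
    |orbitAverage d H a (fun t => Real.cos (2 * Real.pi * n * (t + y))) g| ≤
      (1 / (H.card : ℝ)) *
        ‖∑ h ∈ H, ZMod.stdAddChar ((n : ZMod d) * ((a * (g * h) : (ZMod d)ˣ) : ZMod d))‖ := by
  unfold orbitAverage
  simp only [cos_residuePoint_eq]
  rw [abs_mul, abs_of_nonneg (by positivity : (0 : ℝ) ≤ 1 / (H.card : ℝ)), ← Complex.re_sum,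
    ← Finset.mul_sum]
  gcongr
  refine (Complex.abs_re_le_norm _).trans ?_
  rw [norm_mul, Complex.norm_exp_ofReal_mul_I, one_mul]

theorem unitsMeanAbs_mono {d : ℕ+} {X Y : (ZMod d)ˣ → ℝ} (h : ∀ g, |X g| ≤ |Y g|) :
    unitsMeanAbs d X ≤ unitsMeanAbs d Y := by
  unfold unitsMeanAbs
  exact mul_le_mul_of_nonneg_left (Finset.sum_le_sum fun g _ => h g) (by positivity)

theorem unitsMeanAbs_sum_le {d : ℕ+} {ι : Type*} (s : Finset ι) (c : ι → ℝ)
    (X : ι → (ZMod d)ˣ → ℝ) :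
    unitsMeanAbs d (fun g => ∑ i ∈ s, c i * X i g) ≤ ∑ i ∈ s, |c i| * unitsMeanAbs d (X i) := by
  unfold unitsMeanAbs
  calc _ ≤ (1 / (Nat.totient d : ℝ)) * ∑ g : (ZMod d)ˣ, ∑ i ∈ s, |c i| * |X i g| := by
        gcongr with g
        refine (Finset.abs_sum_le_sum_abs _ _).trans_eq ?_
        simp only [abs_mul]
    _ = _ := by
        rw [Finset.sum_comm, Finset.mul_sum]
        refine Finset.sum_congr rfl fun i _ => ?_
        rw [← Finset.mul_sum]
        ring

theorem summable_inv_sq_mul_sqrt : Summable fun n : ℕ => 1 / (n : ℝ) ^ 2 * √n := by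
  have h : Summable fun n : ℕ => (n : ℝ) ^ (-(3 / 2) : ℝ) :=
    Real.summable_nat_rpow.2 (by norm_num)
  refine h.congr fun n => ?_
  rcases Nat.eq_zero_or_pos n with rfl | hn
  · simp
  · have hn' : (0 : ℝ) < n := by exact_mod_cast hn
    rw [Real.sqrt_eq_rpow, one_div, ← Real.rpow_natCast, ← Real.rpow_neg hn'.le,
      ← Real.rpow_add hn']
    norm_num

/-- A bound for the means of the shifted primitive, obtained from its Fourier series. -/
theorem unitsMeanAbs_sawtoothPrimitive_le (d : ℕ+) {H : Finset (ZMod d)ˣ} (hH : H.Nonempty)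
    (a : (ZMod d)ˣ) (y : ℝ) :
    unitsMeanAbs d (orbitAverage d H a fun t => sawtoothPrimitive (t + y)) ≤
      (∑' n : ℕ, 1 / (n : ℝ) ^ 2 * √n) * √((d : ℝ) / Nat.totient d / H.card) := by
  set R := √((d : ℝ) / Nat.totient d / H.card) with hR
  set X : ℕ → (ZMod d)ˣ → ℝ := fun n =>
    orbitAverage d H a (fun t => Real.cos (2 * Real.pi * n * (t + y))) with hX
  have hc : ∀ n : ℕ, |1 / (2 * Real.pi ^ 2) * (1 / (n : ℝ) ^ 2)| ≤ 1 / (n : ℝ) ^ 2 := by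
    intro n
    rw [abs_of_nonneg (by positivity)]
    refine mul_le_of_le_one_left (by positivity) ?_
    have := Real.pi_gt_three
    rw [div_le_one (by positivity)]
    nlinarith
  have hXn : ∀ n : ℕ, |1 / (2 * Real.pi ^ 2) * (1 / (n : ℝ) ^ 2)| * unitsMeanAbs d (X n) ≤
      (1 / (n : ℝ) ^ 2 * √n) * R := by
    intro n
    -- The frequency 0, to which the exponential sum bound does not apply, has coefficient `1 / 0 ^
    -- 2 = 0`.
    rcases Nat.eq_zero_or_pos n with rfl | hn
    · simp
    · rw [mul_assoc]
      refine mul_le_mul (hc n) ?_ (by unfold unitsMeanAbs; positivity) (by positivity)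
      refine le_trans ?_ (mean_norm_expSum_le d hn hH a)
      unfold unitsMeanAbs
      gcongr with g
      exact abs_orbitAverage_cos_le d H a n y g
  have hlim : Tendsto (fun N => unitsMeanAbs d
      (fun g => ∑ n ∈ Finset.range N, 1 / (2 * Real.pi ^ 2) * (1 / (n : ℝ) ^ 2) * X n g)) atTop
      (nhds (unitsMeanAbs d (orbitAverage d H a fun t => sawtoothPrimitive (t + y)))) := by
    unfold unitsMeanAbs
    refine Tendsto.const_mul _ (tendsto_finsetSum _ fun g _ => Tendsto.abs ?_)
    refine HasSum.tendsto_sum_nat ?_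
    have := (hasSum_sum (s := H) fun h _ => hasSum_sawtoothPrimitive
      (residuePoint d ((a * (g * h) : (ZMod d)ˣ) : ZMod d) + y)).mul_left (1 / (H.card : ℝ))
    refine this.congr_fun fun n => ?_
    simp only [hX, orbitAverage]
    rw [← Finset.mul_sum, ← Finset.mul_sum]
    ring
  refine le_of_tendsto' hlim fun N => ?_
  refine (unitsMeanAbs_sum_le _ _ _).trans ?_
  calc _ ≤ ∑ n ∈ Finset.range N, (1 / (n : ℝ) ^ 2 * √n) * R := Finset.sum_le_sum fun n _ => hXn n
    _ = (∑ n ∈ Finset.range N, 1 / (n : ℝ) ^ 2 * √n) * R := by rw [Finset.sum_mul]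
    _ ≤ _ := by
        gcongr
        exact summable_inv_sq_mul_sqrt.sum_le_tsum _ fun n _ => by positivity

theorem orbitAverage_mono {d : ℕ+} {H : Finset (ZMod d)ˣ} {a : (ZMod d)ˣ} {f f' : ℝ → ℝ}
    (h : ∀ t, f t ≤ f' t) (g : (ZMod d)ˣ) : orbitAverage d H a f g ≤ orbitAverage d H a f' g := by
  unfold orbitAverage
  exact mul_le_mul_of_nonneg_left (Finset.sum_le_sum fun _ _ => h _) (by positivity)

theorem orbitAverage_add (d : ℕ+) (H : Finset (ZMod d)ˣ) (a : (ZMod d)ˣ) (f f' : ℝ → ℝ)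
    (g : (ZMod d)ˣ) : orbitAverage d H a (fun t => f t + f' t) g =
      orbitAverage d H a f g + orbitAverage d H a f' g := by
  unfold orbitAverage
  rw [Finset.sum_add_distrib, mul_add]

theorem orbitAverage_sub (d : ℕ+) (H : Finset (ZMod d)ˣ) (a : (ZMod d)ˣ) (f f' : ℝ → ℝ)
    (g : (ZMod d)ˣ) : orbitAverage d H a (fun t => f t - f' t) g =
      orbitAverage d H a f g - orbitAverage d H a f' g := by
  unfold orbitAverage
  rw [Finset.sum_sub_distrib, mul_sub]

theorem orbitAverage_const_mul (d : ℕ+) (H : Finset (ZMod d)ˣ) (a : (ZMod d)ˣ) (c : ℝ) (f : ℝ → ℝ)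
    (g : (ZMod d)ˣ) : orbitAverage d H a (fun t => c * f t) g = c * orbitAverage d H a f g := by
  unfold orbitAverage
  rw [← Finset.mul_sum]
  ring

theorem orbitAverage_const {d : ℕ+} {H : Finset (ZMod d)ˣ} (hH : H.Nonempty) (a : (ZMod d)ˣ) (c : ℝ)
    (g : (ZMod d)ˣ) : orbitAverage d H a (fun _ => c) g = c := by
  unfold orbitAverage
  have : (H.card : ℝ) ≠ 0 := by exact_mod_cast hH.card_pos.ne'
  rw [Finset.sum_const, nsmul_eq_mul]
  field_simp

theorem unitsMeanAbs_const (d : ℕ+) (c : ℝ) : unitsMeanAbs d (fun _ => c) = |c| := by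
  unfold unitsMeanAbs
  have : (Nat.totient d : ℝ) ≠ 0 := by exact_mod_cast (Nat.totient_pos.2 d.pos).ne'
  rw [Finset.sum_const, Finset.card_univ, ZMod.card_units_eq_totient, nsmul_eq_mul]
  field_simp

theorem unitsMeanAbs_add_le {d : ℕ+} (X Y : (ZMod d)ˣ → ℝ) :
    unitsMeanAbs d (fun g => X g + Y g) ≤ unitsMeanAbs d X + unitsMeanAbs d Y := by
  unfold unitsMeanAbs
  rw [← mul_add, ← Finset.sum_add_distrib]
  gcongr with g
  exact abs_add_le _ _

theorem unitsMeanAbs_abs {d : ℕ+} (X : (ZMod d)ˣ → ℝ) :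
    unitsMeanAbs d (fun g => |X g|) = unitsMeanAbs d X := by
  simp [unitsMeanAbs]

theorem unitsMeanAbs_const_mul (d : ℕ+) (c : ℝ) (X : (ZMod d)ˣ → ℝ) :
    unitsMeanAbs d (fun g => c * X g) = |c| * unitsMeanAbs d X := by
  unfold unitsMeanAbs
  simp only [abs_mul, ← Finset.mul_sum]
  ring

/-- Passage from the smooth primitive to the sawtooth, at the cost of a step `δ`. -/
theorem unitsMeanAbs_sawtooth_le {d : ℕ+} {H : Finset (ZMod d)ˣ} (hH : H.Nonempty) (a : (ZMod d)ˣ)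
    {δ M : ℝ} (hδ : 0 < δ) (hδ' : δ < 1)
    (hM : ∀ y, unitsMeanAbs d (orbitAverage d H a fun t => sawtoothPrimitive (t + y)) ≤ M) (y : ℝ) :
    unitsMeanAbs d (orbitAverage d H a fun t => sawtooth (t + y)) ≤ δ + 3 * M / δ := by
  set P : ℝ → (ZMod d)ˣ → ℝ := fun y => orbitAverage d H a fun t => sawtoothPrimitive (t + y) with hP
  set S : (ZMod d)ˣ → ℝ := orbitAverage d H a fun t => sawtooth (t + y) with hS
  have hlow : ∀ g, P (y + δ) g - P y g ≤ δ * S g + δ ^ 2 := by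
    intro g
    have h := orbitAverage_mono (d := d) (H := H) (a := a) (fun t =>
      sawtoothPrimitive_add_sub_le (t := t + y) hδ.le hδ') g
    rw [orbitAverage_sub, orbitAverage_add, orbitAverage_const_mul, orbitAverage_const hH] at h
    simpa only [hP, add_assoc] using h
  have hup : ∀ g, δ * S g ≤ P y g - P (y + -δ) g + δ ^ 2 := by
    intro g
    have h := orbitAverage_mono (d := d) (H := H) (a := a) (fun t =>
      mul_sawtooth_le_sub (t := t + y) hδ.le hδ') g
    rw [orbitAverage_add, orbitAverage_sub, orbitAverage_const_mul, orbitAverage_const hH] at h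
    simpa only [hP, add_assoc, sub_eq_add_neg] using h
  -- Both one-sided bounds are weakened to a common majorant built from the translates by `y + δ`,
  -- `y` and `y - δ`, which gives the factor 3 in front of `M`.
  have habs : ∀ g, |δ * S g| ≤ |δ ^ 2 + (|P (y + δ) g| + (|P y g| + |P (y + -δ) g|))| := by
    intro g
    refine le_trans ?_ (le_abs_self _)
    have h1 := hlow g
    have h2 := hup g
    have := neg_abs_le (P (y + δ) g)
    have := le_abs_self (P (y + δ) g)
    have := neg_abs_le (P y g)
    have := le_abs_self (P y g)
    have := neg_abs_le (P (y + -δ) g)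
    have := le_abs_self (P (y + -δ) g)
    rw [abs_le]
    constructor <;> linarith
  have hmain := unitsMeanAbs_mono habs
  rw [unitsMeanAbs_const_mul, abs_of_pos hδ] at hmain
  have h1 := unitsMeanAbs_add_le (fun _ => δ ^ 2)
    (fun g => |P (y + δ) g| + (|P y g| + |P (y + -δ) g|))
  have h2 := unitsMeanAbs_add_le (fun g => |P (y + δ) g|) (fun g => |P y g| + |P (y + -δ) g|)
  have h3 := unitsMeanAbs_add_le (fun g => |P y g|) (fun g => |P (y + -δ) g|)
  rw [unitsMeanAbs_const, abs_of_nonneg (sq_nonneg δ)] at h1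
  rw [unitsMeanAbs_abs] at h2 h3
  rw [unitsMeanAbs_abs] at h3
  have h4 := hM (y + δ)
  have h5 := hM y
  have h6 := hM (y + -δ)
  have h7 : δ * unitsMeanAbs d S ≤ δ ^ 2 + 3 * M := by
    simp only [hP] at h1 h2 h3 hmain
    linarith
  have h8 : δ + 3 * M / δ = (δ ^ 2 + 3 * M) / δ := by field_simp
  rw [h8, le_div_iff₀ hδ]
  linarith

theorem unitsMeanAbs_discrepancy_le {d : ℕ+} {H : Finset (ZMod d)ˣ} (hH : H.Nonempty)
    (a : (ZMod d)ˣ) {η x : ℝ} (hx : 0 ≤ x) (hx' : x ≤ 1)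
    (hη : ∀ y, unitsMeanAbs d (orbitAverage d H a fun t => sawtooth (t + y)) ≤ η) :
    unitsMeanAbs d (fun g => orbitAverage d H a (fun t => if t < x then 1 else 0) g - x) ≤ 2 * η := by
  have heq : ∀ g, orbitAverage d H a (fun t => if t < x then 1 else 0) g - x =
      orbitAverage d H a (fun t => sawtooth (t + (-x))) g +
        (-1) * orbitAverage d H a (fun t => sawtooth (t + 0)) g := by
    intro g
    have h1 : orbitAverage d H a (fun t => (if t < x then 1 else 0) - x) g =
        orbitAverage d H a (fun t => sawtooth (t + (-x)) - sawtooth (t + 0)) g := by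
      unfold orbitAverage
      congr 1
      refine Finset.sum_congr rfl fun h _ => ?_
      exact ite_lt_sub_eq_sawtooth_sub (Int.fract_nonneg _) (Int.fract_lt_one _) hx hx'
    rw [orbitAverage_sub, orbitAverage_sub, orbitAverage_const hH] at h1
    rw [h1]
    ring
  simp only [heq]
  refine (unitsMeanAbs_add_le _ _).trans ?_
  rw [unitsMeanAbs_const_mul, abs_neg, abs_one, one_mul]
  linarith [hη (-x), hη 0]

/-! ### Abel summation, variation on grid cells and Koksma's inequality. -/

theorem eq_sub_sum_range_ite (f : ℕ → ℝ) {j N : ℕ} (h : j ≤ N) :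
    f j = f N - ∑ i ∈ Finset.range N, (f (i + 1) - f i) * (if j ≤ i then 1 else 0) := by
  induction N, h using Nat.le_induction with
  | base =>
    rw [Finset.sum_eq_zero, sub_zero]
    intro i hi
    rw [if_neg (by simpa using hi), mul_zero]
  | succ N hN ih =>
    rw [Finset.sum_range_succ, if_pos hN]
    linarith

theorem sum_range_eq_mul_sub (f : ℕ → ℝ) (N : ℕ) :
    ∑ i ∈ Finset.range N, f i =
      N * f N - ∑ i ∈ Finset.range N, (f (i + 1) - f i) * ((i : ℝ) + 1) := by
  induction N with
  | zero => simp
  | succ N ih =>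
    rw [Finset.sum_range_succ, Finset.sum_range_succ, ih]
    push_cast
    ring

theorem BoundedVariationOn.intervalIntegrable_of_Icc {F : ℝ → ℝ} {a b : ℝ} (hab : a ≤ b)
    (hF : BoundedVariationOn F (Set.Icc a b)) : IntervalIntegrable F MeasureTheory.volume a b := by
  obtain ⟨p, q, hp, hq, rfl⟩ := hF.locallyBoundedVariationOn.exists_monotoneOn_sub_monotoneOn
  rw [← Set.uIcc_of_le hab] at hp hq
  exact hp.intervalIntegrable.sub hq.intervalIntegrable

theorem sum_eVariationOn_Icc_div (F : ℝ → ℝ) (d k : ℕ) :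
    ∑ i ∈ Finset.range k, eVariationOn F (Set.Icc ((i : ℝ) / d) (((i + 1 : ℕ) : ℝ) / d)) =
      eVariationOn F (Set.Icc 0 ((k : ℝ) / d)) := by
  induction k with
  | zero => simp [eVariationOn.subsingleton]
  | succ k ih =>
    rw [Finset.sum_range_succ, ih]
    have h := eVariationOn.Icc_add_Icc F (s := Set.univ) (a := 0) (b := (k : ℝ) / d)
      (c := ((k + 1 : ℕ) : ℝ) / d) (by positivity) (by push_cast; gcongr; linarith)
      (Set.mem_univ _)
    simpa only [Set.univ_inter] using h

/-- The variation of `F` on the `i`-th cell of the grid of step `1 / d`. -/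
noncomputable def cellVariation (F : ℝ → ℝ) (d : ℕ+) (i : ℕ) : ℝ :=
  (eVariationOn F (Set.Icc ((i : ℝ) / (d : ℕ)) (((i + 1 : ℕ) : ℝ) / (d : ℕ)))).toReal

theorem cell_subset {d : ℕ+} {i : ℕ} (hi : i < d) :
    Set.Icc ((i : ℝ) / (d : ℕ)) (((i + 1 : ℕ) : ℝ) / (d : ℕ)) ⊆ Set.Icc 0 1 := by
  have hd : (0 : ℝ) < (d : ℕ) := by exact_mod_cast d.pos
  refine Set.Icc_subset_Icc (by positivity) ((div_le_one hd).2 ?_)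
  exact_mod_cast hi

theorem cell_le (d : ℕ+) (i : ℕ) : (i : ℝ) / (d : ℕ) ≤ ((i + 1 : ℕ) : ℝ) / (d : ℕ) := by
  push_cast
  gcongr
  linarith

theorem sum_cellVariation {F : ℝ → ℝ} (hF : BoundedVariationOn F (Set.Icc 0 1)) (d : ℕ+) :
    ∑ i ∈ Finset.range d, cellVariation F d i = totalVariation F := by
  have hd : ((d : ℕ) : ℝ) ≠ 0 := by exact_mod_cast d.pos.ne'
  unfold cellVariation totalVariation
  rw [← ENNReal.toReal_sum, sum_eVariationOn_Icc_div, div_self hd]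
  intro i hi
  exact hF.mono (cell_subset (Finset.mem_range.1 hi))

theorem abs_sub_le_cellVariation {F : ℝ → ℝ} (hF : BoundedVariationOn F (Set.Icc 0 1))
    {d : ℕ+} {i : ℕ} (hi : i < d) {t : ℝ}
    (ht : t ∈ Set.Icc ((i : ℝ) / (d : ℕ)) (((i + 1 : ℕ) : ℝ) / (d : ℕ))) :
    |F t - F ((i : ℝ) / (d : ℕ))| ≤ cellVariation F d i :=
  (hF.mono (cell_subset hi)).dist_le ht (Set.left_mem_Icc.2 (cell_le d i))

theorem abs_integral_sub_riemannSum_le {F : ℝ → ℝ} (hF : BoundedVariationOn F (Set.Icc 0 1))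
    (d : ℕ+) :
    |(∫ t in (0 : ℝ)..1, F t) - (1 / ((d : ℕ) : ℝ)) * ∑ i ∈ Finset.range d, F ((i : ℝ) / (d : ℕ))| ≤
      totalVariation F / (d : ℕ) := by
  have hd : (0 : ℝ) < ((d : ℕ) : ℝ) := by exact_mod_cast d.pos
  have hint : ∀ i < (d : ℕ), IntervalIntegrable F MeasureTheory.volume
      ((i : ℝ) / (d : ℕ)) (((i + 1 : ℕ) : ℝ) / (d : ℕ)) := fun i hi =>
    (hF.mono (cell_subset hi)).intervalIntegrable_of_Icc (cell_le d i)
  have hsplit := intervalIntegral.sum_integral_adjacent_intervals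
    (a := fun i : ℕ => (i : ℝ) / (d : ℕ)) hint
  simp only [Nat.cast_zero, zero_div, div_self hd.ne'] at hsplit
  rw [← hsplit, Finset.mul_sum, ← Finset.sum_sub_distrib, ← sum_cellVariation hF d, Finset.sum_div]
  refine (Finset.abs_sum_le_sum_abs _ _).trans (Finset.sum_le_sum fun i hi => ?_)
  have hi' := Finset.mem_range.1 hi
  have hlen : ((i + 1 : ℕ) : ℝ) / (d : ℕ) - (i : ℝ) / (d : ℕ) = 1 / ((d : ℕ) : ℝ) := by
    push_cast
    ring
  have hconst : (1 / ((d : ℕ) : ℝ)) * F ((i : ℝ) / (d : ℕ)) =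
      ∫ _ in ((i : ℝ) / (d : ℕ))..(((i + 1 : ℕ) : ℝ) / (d : ℕ)), F ((i : ℝ) / (d : ℕ)) := by
    rw [intervalIntegral.integral_const, hlen, smul_eq_mul]
  rw [hconst, ← intervalIntegral.integral_sub (hint i hi') intervalIntegrable_const]
  have h := intervalIntegral.norm_integral_le_of_norm_le_const
    (a := (i : ℝ) / (d : ℕ)) (b := ((i + 1 : ℕ) : ℝ) / (d : ℕ)) (C := cellVariation F d i)
    (f := fun t => F t - F ((i : ℝ) / (d : ℕ))) (fun t ht => by
      rw [Set.uIoc_of_le (cell_le d i)] at ht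
      exact abs_sub_le_cellVariation hF hi' (Set.Ioc_subset_Icc_self ht))
  rw [hlen, abs_of_pos (by positivity), mul_one_div] at h
  exact h

/-- All orbit points lie on the grid `i / d`, so Abel summation needs no regularity of `F`. The
orbit average and the Riemann sum both expand as `F 1` minus weighted increments of `F`; their
difference carries the discrepancies as weights. The strict condition `t < (i + 1) / d` selects the
grid points `j / d` with `j ≤ i`. -/
theorem orbitAverage_eq (d : ℕ+) (F : ℝ → ℝ) {H : Finset (ZMod d)ˣ} (hH : H.Nonempty) (a g : (ZMod d)ˣ) :
    orbitAverage d H a F g = (1 / ((d : ℕ) : ℝ)) * ∑ i ∈ Finset.range d, F ((i : ℝ) / (d : ℕ)) -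
      ∑ i ∈ Finset.range d, (F (((i + 1 : ℕ) : ℝ) / (d : ℕ)) - F ((i : ℝ) / (d : ℕ))) *
        (orbitAverage d H a (fun t => if t < ((i : ℝ) + 1) / (d : ℕ) then 1 else 0) g -
          ((i : ℝ) + 1) / (d : ℕ)) := by
  have hd : (0 : ℝ) < ((d : ℕ) : ℝ) := by exact_mod_cast d.pos
  set f : ℕ → ℝ := fun i => F ((i : ℝ) / (d : ℕ)) with hf
  have hpt : ∀ m : ZMod d, F (residuePoint d m) = f d - ∑ i ∈ Finset.range d, (f (i + 1) - f i) *
      (if residuePoint d m < ((i : ℝ) + 1) / (d : ℕ) then 1 else 0) := by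
    intro m
    have h := eq_sub_sum_range_ite f (ZMod.val_lt m).le
    rw [residuePoint_eq]
    refine h.trans ?_
    congr 1
    refine Finset.sum_congr rfl fun i _ => ?_
    congr 1
    refine if_congr ?_ rfl rfl
    rw [div_lt_div_iff_of_pos_right hd]
    norm_cast
    exact Nat.lt_succ_iff.symm
  have h1 : orbitAverage d H a F g = f d - ∑ i ∈ Finset.range d, (f (i + 1) - f i) *
      orbitAverage d H a (fun t => if t < ((i : ℝ) + 1) / (d : ℕ) then 1 else 0) g := by
    have hc : (H.card : ℝ) ≠ 0 := by exact_mod_cast hH.card_pos.ne'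
    unfold orbitAverage
    simp only [hpt]
    rw [Finset.sum_sub_distrib, Finset.sum_const, nsmul_eq_mul, mul_sub, ← mul_assoc,
      one_div_mul_cancel hc, one_mul, Finset.sum_comm, Finset.mul_sum]
    congr 1
    refine Finset.sum_congr rfl fun i _ => ?_
    rw [← Finset.mul_sum]
    ring
  have h2 : (1 / ((d : ℕ) : ℝ)) * ∑ i ∈ Finset.range d, f i =
      f d - ∑ i ∈ Finset.range d, (f (i + 1) - f i) * (((i : ℝ) + 1) / (d : ℕ)) := by
    rw [sum_range_eq_mul_sub, mul_sub, ← mul_assoc, one_div_mul_cancel hd.ne', one_mul,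
      Finset.mul_sum]
    congr 1
    refine Finset.sum_congr rfl fun i _ => ?_
    ring
  change _ = (1 / ((d : ℕ) : ℝ)) * ∑ i ∈ Finset.range d, f i - ∑ i ∈ Finset.range d,
    (f (i + 1) - f i) * _
  rw [h1, h2]
  simp only [mul_sub, Finset.sum_sub_distrib]
  ring

/-- A mean form of Koksma's inequality. -/
theorem meanDeviation_le {F : ℝ → ℝ} (hF : BoundedVariationOn F (Set.Icc 0 1))
    (d : ℕ+) {H : Finset (ZMod d)ˣ} (hH : H.Nonempty) (a : (ZMod d)ˣ) {η : ℝ}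
    (hη : ∀ x : ℝ, 0 ≤ x → x ≤ 1 → unitsMeanAbs d
      (fun g => orbitAverage d H a (fun t => if t < x then 1 else 0) g - x) ≤ η) :
    meanDeviation F d H a ≤ totalVariation F * (1 / ((d : ℕ) : ℝ) + η) := by
  have hd : (0 : ℝ) < ((d : ℕ) : ℝ) := by exact_mod_cast d.pos
  have hη0 : 0 ≤ η := le_trans (by unfold unitsMeanAbs; positivity) (hη 0 le_rfl zero_le_one)
  set R := (∫ t in (0 : ℝ)..1, F t) -
    (1 / ((d : ℕ) : ℝ)) * ∑ i ∈ Finset.range d, F ((i : ℝ) / (d : ℕ)) with hR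
  set c : ℕ → ℝ := fun i => F (((i + 1 : ℕ) : ℝ) / (d : ℕ)) - F ((i : ℝ) / (d : ℕ)) with hc
  set X : ℕ → (ZMod d)ˣ → ℝ := fun i g =>
    orbitAverage d H a (fun t => if t < ((i : ℝ) + 1) / (d : ℕ) then 1 else 0) g -
      ((i : ℝ) + 1) / (d : ℕ) with hX
  have h1 : meanDeviation F d H a =
      unitsMeanAbs d (fun g => R + ∑ i ∈ Finset.range d, c i * X i g) := by
    change unitsMeanAbs d (fun g => (∫ t in (0 : ℝ)..1, F t) - orbitAverage d H a F g) = _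
    congr 1
    funext g
    rw [orbitAverage_eq d F hH a g, hR]
    ring
  rw [h1]
  calc _ ≤ unitsMeanAbs d (fun _ => R) +
        unitsMeanAbs d (fun g => ∑ i ∈ Finset.range d, c i * X i g) := unitsMeanAbs_add_le _ _
    _ ≤ totalVariation F / (d : ℕ) + ∑ i ∈ Finset.range d, |c i| * unitsMeanAbs d (X i) := by
        rw [unitsMeanAbs_const]
        exact add_le_add (abs_integral_sub_riemannSum_le hF d) (unitsMeanAbs_sum_le _ _ _)
    _ ≤ totalVariation F / (d : ℕ) + ∑ i ∈ Finset.range d, cellVariation F d i * η := by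
        gcongr with i hi
        · unfold unitsMeanAbs
          positivity
        · exact ENNReal.toReal_nonneg
        · exact abs_sub_le_cellVariation hF (Finset.mem_range.1 hi)
            (Set.right_mem_Icc.2 (cell_le d i))
        · refine hη _ (by positivity) ((div_le_one hd).2 ?_)
          exact_mod_cast Finset.mem_range.1 hi
    _ = _ := by
        rw [← Finset.sum_mul, sum_cellVariation hF d]
        ring

/-! ### Choice of the step and conclusion. -/

/-- The mean deviation is `O(q ^ (1 / 4))` with `q = log log d / |H|`. -/
theorem exists_meanDeviation_le : ∃ C : ℝ, ∀ {F : ℝ → ℝ}, BoundedVariationOn F (Set.Icc 0 1) →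
    ∀ (d : ℕ+) (H : Finset (ZMod d)ˣ) (a : (ZMod d)ˣ), H.Nonempty →
      1 ≤ Real.log (Real.log (d : ℝ)) → Real.log (Real.log (d : ℝ)) / (H.card : ℝ) < 1 →
      meanDeviation F d H a ≤ totalVariation F *
        (C * (Real.log (Real.log (d : ℝ)) / (H.card : ℝ)) ^ (1 / 4 : ℝ)) := by
  set K : ℝ := ∑' n : ℕ, 1 / (n : ℝ) ^ 2 * √n with hK
  have hK0 : 0 ≤ K := tsum_nonneg fun n => by positivity
  -- One unit of the 3 absorbs `1 / d`; the other two, and `6 * K = 2 * (3 * K)`, are twice the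
  -- sawtooth bound `δ + 3 * M / δ`.
  refine ⟨3 + 6 * K * √(2 * Real.exp 6), ?_⟩
  intro F hF d H a hH hd hq
  have hc : (0 : ℝ) < H.card := by exact_mod_cast hH.card_pos
  have hd0 : (0 : ℝ) < ((d : ℕ) : ℝ) := by exact_mod_cast d.pos
  set q : ℝ := Real.log (Real.log (d : ℝ)) / (H.card : ℝ) with hq_def
  have hq0 : 0 < q := div_pos (by linarith) hc
  set r : ℝ := q ^ (1 / 4 : ℝ) with hr
  have hr0 : 0 < r := Real.rpow_pos_of_pos hq0 _
  have hr1 : r < 1 := Real.rpow_lt_one hq0.le hq (by norm_num)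
  have hsqrt : √q = r ^ 2 := by
    rw [Real.sqrt_eq_rpow, hr, ← Real.rpow_natCast, ← Real.rpow_mul hq0.le]
    norm_num
  have hR : √((d : ℝ) / Nat.totient d / H.card) ≤ √(2 * Real.exp 6) * r ^ 2 := by
    rw [← hsqrt, ← Real.sqrt_mul (by positivity)]
    refine Real.sqrt_le_sqrt ?_
    rw [hq_def, ← mul_div_assoc]
    gcongr
    exact div_totient_le hd
  have hM : ∀ y, unitsMeanAbs d (orbitAverage d H a fun t => sawtoothPrimitive (t + y)) ≤
      K * (√(2 * Real.exp 6) * r ^ 2) := fun y =>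
    (unitsMeanAbs_sawtoothPrimitive_le d hH a y).trans (mul_le_mul_of_nonneg_left hR hK0)
  -- The step is `δ = r = q ^ (1 / 4)`: since `M` is a multiple of `r ^ 2`, both terms have order
  -- `r`.
  have hη := unitsMeanAbs_sawtooth_le hH a hr0 hr1 hM
  have hinv : 1 / ((d : ℕ) : ℝ) ≤ r := by
    have hcard : H.card ≤ (d : ℕ) := by
      have h := Finset.card_le_univ H
      rw [ZMod.card_units_eq_totient] at h
      exact h.trans (Nat.totient_le d)
    calc 1 / ((d : ℕ) : ℝ) ≤ 1 / (H.card : ℝ) :=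
          one_div_le_one_div_of_le hc (by exact_mod_cast hcard)
      _ ≤ q := by rw [hq_def]; gcongr
      _ = q ^ (1 : ℝ) := (Real.rpow_one q).symm
      _ ≤ r := Real.rpow_le_rpow_of_exponent_ge hq0 hq.le (by norm_num)
  refine (meanDeviation_le hF d hH a fun x hx hx' =>
    unitsMeanAbs_discrepancy_le hH a hx hx' hη).trans ?_
  refine mul_le_mul_of_nonneg_left ?_ ENNReal.toReal_nonneg
  have h1 : 3 * (K * (√(2 * Real.exp 6) * r ^ 2)) / r = 3 * K * √(2 * Real.exp 6) * r := by
    field_simp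
  rw [h1]
  linarith

theorem mainTheorem6
    (F : ℝ → ℝ) (hF : BoundedVariationOn F (Set.Icc 0 1))
    (D : Set ℕ+) (hD : D.Infinite)
    (H : ∀ d : ℕ+, Finset (ZMod d)ˣ) (a : ∀ d : ℕ+, (ZMod d)ˣ)
    (hH : Tendsto (fun d : ℕ+ => ((H d).card : ℝ) / Real.log (Real.log (d : ℝ)))
      (atTop ⊓ 𝓟 D) atTop)
    (ε : ℝ) (hε : 0 < ε) (hε' : ε < 1 / 4) :
    ∀ᶠ d : ℕ+ in atTop ⊓ 𝓟 D,
      meanDeviation F d (H d) (a d) ≤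
        equidistributionConstant ε * totalVariation F *
          (Real.log (Real.log (d : ℝ)) / ((H d).card : ℝ)) ^ (1 / 4 - ε) := by
  obtain ⟨C, hC⟩ := exists_meanDeviation_le
  have hq : Tendsto (fun d : ℕ+ => Real.log (Real.log (d : ℝ)) / ((H d).card : ℝ))
      (atTop ⊓ 𝓟 D) (nhds 0) :=
    (tendsto_inv_atTop_zero.comp hH).congr fun d => inv_div _ _
  have hqε : Tendsto (fun d : ℕ+ => C * (Real.log (Real.log (d : ℝ)) / ((H d).card : ℝ)) ^ ε)
      (atTop ⊓ 𝓟 D) (nhds 0) := by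
    have h := (hq.rpow_const (Or.inr hε.le)).const_mul C
    rwa [Real.zero_rpow hε.ne', mul_zero] at h
  have hloglog : Tendsto (fun d : ℕ+ => Real.log (Real.log (d : ℝ))) (atTop ⊓ 𝓟 D) atTop :=
    (Real.tendsto_log_atTop.comp (Real.tendsto_log_atTop.comp
      (tendsto_natCast_atTop_atTop.comp tendsto_PNat_val_atTop_atTop))).mono_left inf_le_left
  -- The threshold 12 is the first summand of the explicit constant, whose other summand is
  -- nonnegative. The last condition excludes an empty `H d`, for which the ratio is 0.
  filter_upwards [hq.eventually_lt_const one_pos, hqε.eventually_lt_const (by norm_num : (0 : ℝ) < 12),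
    hloglog.eventually_ge_atTop 1, hH.eventually_gt_atTop 0] with d hd1 hd2 hd3 hd4
  have hne : (H d).Nonempty := by
    rw [Finset.nonempty_iff_ne_empty]
    intro h0
    simp [h0] at hd4
  have hc : (0 : ℝ) < (H d).card := by exact_mod_cast hne.card_pos
  refine (hC hF d (H d) (a d) hne hd3 hd1).trans ?_
  set q := Real.log (Real.log (d : ℝ)) / ((H d).card : ℝ) with hq_def
  have hq0 : 0 < q := div_pos (by linarith) hc
  have hV : 0 ≤ totalVariation F := ENNReal.toReal_nonneg
  have hconst : 12 ≤ equidistributionConstant ε := by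
    unfold equidistributionConstant
    have := Real.pi_pos
    have : 0 ≤ Real.exp Real.eulerMascheroniConstant / (36 * Real.pi ^ 3) * ε⁻¹ ^ 2 := by positivity
    linarith
  have hsplit : q ^ (1 / 4 : ℝ) = q ^ ε * q ^ (1 / 4 - ε) := by
    rw [← Real.rpow_add hq0]
    ring_nf
  have hp : 0 < q ^ (1 / 4 - ε) := Real.rpow_pos_of_pos hq0 _
  rw [hsplit, mul_comm (equidistributionConstant ε), mul_assoc, ← mul_assoc C]
  refine mul_le_mul_of_nonneg_left ?_ hV
  exact mul_le_mul_of_nonneg_right (hd2.le.trans hconst) hp.le
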